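/- Let $R$ be a Noetherian local ring with maximal ideal $m_R$, and let $\mathcal I=\{I_n\}_{n\ge 0}$ be a filtration of $R$, that is, a descending chain of ideals $R=I_0\supseteq I_1\supseteq I_2\supseteq\cdots$ with $I_iI_j\subseteq I_{i+j}$ for all $i,j\ge 0$. Let $R[\mathcal I]=\sum_{n\ge 0}I_nt^n\subseteq R[t]$ and define the analytic spread of $\mathcal I$ by $\ell(\mathcal I)=\dim R[\mathcal I]/m_RR[\mathcal I]$; for an ideal $I$ of $R$, its analytic spread is $\ell(I)=\dim R[It]/m_RR[It]$, where $R[It]=\sum_{n\ge 0}I^nt^n$. The height of $\mathcal I$ is $\operatorname{ht}(\mathcal I)=\operatorname{ht}(I_1)$, which equals $\operatorname{ht}(I_n)$ for every $n\ge 1$. Suppose that $\mathcal I$ is Noetherian, that is, $R[\mathcal I]$ is a finitely generated $R$-algebra. Then: 1. There exists an integer $e>0$ such that $\ell(I_{em})=\ell(\mathcal I)$ for all integers $m>0$. 2. If $I_1\neq R$, then $\operatorname{ht}(\mathcal I)\le\ell(\mathcal I)\le\dim R$. The upper bound $\ell(\mathcal I)\le\dim R$ also holds if $I_1=R$ and $\dim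 R\ge 1$. -/

import Mathlib

open scoped Polynomial

/-- A filtration `R = I₀ ⊇ I₁ ⊇ I₂ ⊇ ⋯` of ideals on a ring `R`, with `Iᵢ Iⱼ ⊆ Iᵢ₊ⱼ`. -/
structure IdealFiltration (R : Type*) [CommRing R] where
  I : ℕ → Ideal R
  zero_eq_top : I 0 = ⊤
  antitone : Antitone I
  mul_le : ∀ i j, I i * I j ≤ I (i + j)

namespace IdealFiltration

/-- The Rees algebra `R[𝓘] = ∑ₙ Iₙ tⁿ` of a filtration, as a subalgebra of `R[t]`. -/
def rees {R : Type*} [CommRing R] (F : IdealFiltration R) : Subalgebra R R[X] where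
  carrier := { f | ∀ n, f.coeff n ∈ F.I n }
  mul_mem' {f g} hf hg n := by
    rw [Polynomial.coeff_mul]
    refine Ideal.sum_mem _ ?_
    rintro ⟨j, k⟩ e
    rw [← Finset.HasAntidiagonal.mem_antidiagonal.mp e]
    exact F.mul_le j k (Ideal.mul_mem_mul (hf j) (hg k))
  add_mem' {f g} hf hg n := by
    rw [Polynomial.coeff_add]
    exact Ideal.add_mem _ (hf n) (hg n)
  algebraMap_mem' r n := by
    rw [Polynomial.algebraMap_apply, Polynomial.coeff_C]
    split_ifs with h
    · subst h
      simp [F.zero_eq_top]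
    · simp

/-- A filtration is Noetherian if its Rees algebra is a finitely generated `R`-algebra. -/
def IsNoetherianFiltration {R : Type*} [CommRing R] (F : IdealFiltration R) : Prop :=
  Algebra.FiniteType R F.rees

/-- The height of a filtration is the height of `I₁`; by `height_eq` below it is the height of
`Iₙ` for every `n ≥ 1`. -/
noncomputable def height {R : Type*} [CommRing R] (F : IdealFiltration R) : ℕ∞ :=
  (F.I 1).height

theorem height_eq {R : Type*} [CommRing R] (F : IdealFiltration R) {n : ℕ} (hn : 1 ≤ n) :
    F.height = (F.I n).height := by
  have hpow : ∀ k, F.I 1 ^ k ≤ F.I k := by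
    intro k
    induction k with
    | zero => simp [F.zero_eq_top]
    | succ k ih =>
      rw [pow_succ]
      exact (Ideal.mul_mono_left ih).trans (F.mul_le k 1)
  have hrad : (F.I n).radical = (F.I 1).radical := by
    apply le_antisymm (Ideal.radical_mono (F.antitone hn))
    rw [← Ideal.radical_pow (F.I 1) (n := n) (by omega)]
    exact Ideal.radical_mono (hpow n)
  rw [height, Ideal.height_eq_inf_minimalPrimes, Ideal.height_eq_inf_minimalPrimes,
    ← Ideal.radical_minimalPrimes (I := F.I n), hrad, Ideal.radical_minimalPrimes]

/-- The analytic spread `ℓ(𝓘) = dim R[𝓘] / m_R R[𝓘]` of a filtration on a local ring. -/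
noncomputable def analyticSpread {R : Type*} [CommRing R] [IsLocalRing R]
    (F : IdealFiltration R) : WithBot ℕ∞ :=
  ringKrullDim (F.rees ⧸ (IsLocalRing.maximalIdeal R).map (algebraMap R F.rees))

end IdealFiltration

/-- The analytic spread `ℓ(I) = dim R[It] / m_R R[It]` of an ideal of a local ring. -/
noncomputable def Ideal.analyticSpread {R : Type*} [CommRing R] [IsLocalRing R]
    (I : Ideal R) : WithBot ℕ∞ :=
  ringKrullDim (reesAlgebra I ⧸
    (IsLocalRing.maximalIdeal R).map (algebraMap R (reesAlgebra I)))

/-! Part 1. Let `R[𝓘]` be generated by `r` homogeneous elements of positive degree, and let `D` be a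
common multiple of the degrees. By pigeonhole, a monomial in them of degree at least `rD` splits off
a power of one generator lying in `I_D`. Hence `I_{em} = I_e ^ m` for `e = D(r+1)`
(`exists_I_mul_eq_pow`), so the Veronese of order `em` is the `I_{em}`-adic filtration. A Veronese
subring has `R[𝓘]` integral over it and `m_R R[𝓘]` contracts to its own extension of `m_R`, so the
spread is unchanged (`analyticSpread_veronese`).

Part 2 uses the extended Rees algebra `E = R[𝓘, t⁻¹]`, in which `t⁻¹` is a nonzerodivisor. Lower
bound: some maximal ideal of `E` over `m_R` contains `t⁻¹` and has height at least `dim R + 1`. The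
dimension inequality for `R/I₁ → E/(t⁻¹)`, whose closed fibre is a quotient of `R[𝓘]/m_R R[𝓘]`,
gives `dim R ≤ dim R/I₁ + ℓ(𝓘)`. Upper bound: by part 1 it suffices to treat the adic filtration of
`I_e`. If `I_e ≠ R`, the fibre ring is a quotient of `E/(t⁻¹)`, and `dim E ≤ dim R + 1`. If `I_e =
R`, the fibre ring is a polynomial ring in one variable over the residue field. -/

/-! ### Krull dimension: integral extensions and quotients -/

/-- Lying over and going up lift chains of primes; incomparability keeps contracted chains strict.
-/
theorem Algebra.IsIntegral.ringKrullDim_eq_of_injective {A B : Type*} [CommRing A] [CommRing B]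
    [Algebra A B] [Algebra.IsIntegral A B] (h : Function.Injective (algebraMap A B)) :
    ringKrullDim A = ringKrullDim B := by
  apply le_antisymm
  · refine iSup_le fun l ↦ ?_
    obtain ⟨Q, -, hQ, hQl⟩ := Ideal.exists_ideal_over_prime_of_isIntegral
      l.head.asIdeal (⊥ : Ideal B) (by
        rw [← RingHom.ker_eq_comap_bot, (RingHom.injective_iff_ker_eq_bot _).mp h]; exact bot_le)
    have : Q.LiesOver l.head.asIdeal := ⟨hQl.symm⟩
    obtain ⟨L, hL, -⟩ := Ideal.exists_ltSeries_of_hasGoingUp l Q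
    rw [← hL]
    exact Order.LTSeries.length_le_krullDim L
  · refine Order.krullDim_le_of_strictMono (PrimeSpectrum.comap (algebraMap A B)) fun P Q hPQ ↦ ?_
    exact Ideal.IsIntegral.comap_lt_comap (R := A) (I := P.asIdeal) (J := Q.asIdeal) hPQ

theorem RingHom.IsIntegral.ringKrullDim_eq_of_injective {A B : Type*} [CommRing A] [CommRing B]
    (f : A →+* B) (hf : f.IsIntegral) (h : Function.Injective f) :
    ringKrullDim A = ringKrullDim B := by
  algebraize [f]
  exact Algebra.IsIntegral.ringKrullDim_eq_of_injective h

theorem RingHom.IsIntegral.ringKrullDim_quotient_comap {A B : Type*} [CommRing A] [CommRing B]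
    (f : A →+* B) (hf : f.IsIntegral) (J : Ideal B) :
    ringKrullDim (A ⧸ J.comap f) = ringKrullDim (B ⧸ J) := by
  refine RingHom.IsIntegral.ringKrullDim_eq_of_injective
    (Ideal.quotientMap J f le_rfl) ?_ Ideal.quotientMap_injective
  apply RingHom.IsIntegral.tower_top (Ideal.Quotient.mk _)
  rw [Ideal.quotientMap_comp_mk]
  exact hf.trans _ _ (RingHom.isIntegral_of_surjective _ Ideal.Quotient.mk_surjective)

theorem Ideal.height_add_ringKrullDim_quotient_le {R : Type*} [CommRing R] (I : Ideal R)
    (hI : I ≠ ⊤) : (I.height : WithBot ℕ∞) + ringKrullDim (R ⧸ I) ≤ ringKrullDim R := by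
  -- A chain of primes above `I` can be prolonged downwards by the height of its smallest member.
  have key : ∀ l : LTSeries (PrimeSpectrum R),
      l.head.asIdeal.height + l.length ≤ l.last.asIdeal.height := by
    intro l
    induction l using RelSeries.inductionOn with
    | singleton q => simp
    | cons l q lt ih =>
      simp only [RelSeries.head_cons, RelSeries.cons_length, RelSeries.last_cons]
      refine le_trans ?_ ih
      push_cast
      rw [add_comm (l.length : ℕ∞), ← add_assoc]
      gcongr
      exact Ideal.height_add_one_le_of_lt_of_isPrime lt
  have := Ideal.Quotient.nontrivial_iff.mpr hI
  have : Nonempty (PrimeSpectrum.zeroLocus (I : Set R)) := by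
    rwa [Set.nonempty_coe_sort, Set.nonempty_iff_ne_empty, ne_eq,
      PrimeSpectrum.zeroLocus_empty_iff_eq_top]
  rw [ringKrullDim_quotient, Order.krullDim_eq_iSup_length (α := PrimeSpectrum.zeroLocus (I : Set R))]
  rw [← WithBot.coe_add, ENat.add_iSup]
  have : Nontrivial R := (Ideal.Quotient.mk I).domain_nontrivial
  rw [← Ideal.sup_isPrime_height_eq_ringKrullDim, WithBot.coe_le_coe]
  refine iSup_le fun l ↦ ?_
  have h := key (l.map Subtype.val fun _ _ ↦ id)
  refine le_trans ?_ (h.trans ?_)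
  · gcongr
    · exact l.head.2
    · rfl
  · exact le_iSup₂_of_le _ (l.last : PrimeSpectrum R).isPrime le_rfl

/-! ### Rees algebras and their Veronese subrings -/

namespace IdealFiltration

variable {R : Type*} [CommRing R]

theorem monomial_mem_rees (F : IdealFiltration R) {n : ℕ} {a : R} (ha : a ∈ F.I n) :
    Polynomial.monomial n a ∈ F.rees := by
  intro k
  rw [Polynomial.coeff_monomial]
  split_ifs with h
  · exact h ▸ ha
  · exact zero_mem _

theorem eq_sum_monomial (F : IdealFiltration R) (f : F.rees) :
    f = ∑ n ∈ (f : R[X]).support, ⟨_, F.monomial_mem_rees (f.2 n)⟩ := by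
  apply Subtype.ext
  rw [AddSubmonoidClass.coe_finsetSum]
  exact (f : R[X]).as_sum_support

/-- The extended ideal is homogeneous, so membership can be tested degree by degree. -/
theorem mem_map_algebraMap_rees_iff (F : IdealFiltration R) (a : Ideal R) {f : F.rees} :
    f ∈ a.map (algebraMap R F.rees) ↔ ∀ n, (f : R[X]).coeff n ∈ a * F.I n := by
  constructor
  · intro hf
    induction hf using Submodule.span_induction with
    | mem x hx =>
      obtain ⟨r, hr, rfl⟩ := hx
      intro n
      rw [Subalgebra.coe_algebraMap, Polynomial.algebraMap_apply, Polynomial.coeff_C]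
      split_ifs with h
      · subst h
        simpa [F.zero_eq_top] using hr
      · exact zero_mem _
    | zero => simp
    | add x y _ _ hx hy =>
      intro n
      simpa using add_mem (hx n) (hy n)
    | smul x y _ hy =>
      intro n
      rw [smul_eq_mul, MulMemClass.coe_mul, Polynomial.coeff_mul]
      refine Ideal.sum_mem _ fun ⟨i, j⟩ hij ↦ ?_
      rw [← Finset.HasAntidiagonal.mem_antidiagonal.mp hij]
      refine (Ideal.mul_mono_right (F.mul_le i j)) ?_
      rw [mul_left_comm]
      exact Ideal.mul_mem_mul (x.2 i) (hy j)
  · intro hf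
    have key : ∀ (n : ℕ) (c : R), c ∈ a * F.I n → ∀ g : F.rees,
        (g : R[X]) = Polynomial.monomial n c → g ∈ a.map (algebraMap R F.rees) := by
      intro n c hc
      induction hc using Submodule.mul_induction_on' with
      | mem_mul_mem r hr s hs =>
        intro g hg
        have : g = algebraMap R F.rees r * ⟨_, F.monomial_mem_rees hs⟩ := by
          apply Subtype.ext
          rw [hg, MulMemClass.coe_mul, Subalgebra.coe_algebraMap, Polynomial.algebraMap_apply,
            Algebra.algebraMap_self_apply, Polynomial.C_mul_monomial]
        rw [this]
        exact Ideal.mul_mem_right _ _ (Ideal.mem_map_of_mem _ hr)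
      | add x hx y hy ihx ihy =>
        intro g hg
        have hle : a * F.I n ≤ F.I n := Ideal.mul_le_right
        have : g = ⟨_, F.monomial_mem_rees (hle hx)⟩ + ⟨_, F.monomial_mem_rees (hle hy)⟩ :=
          Subtype.ext (hg.trans (map_add _ _ _))
        rw [this]
        exact add_mem (ihx _ rfl) (ihy _ rfl)
    rw [F.eq_sum_monomial f]
    exact Ideal.sum_mem _ fun n _ ↦ key n _ (hf n) _ rfl

theorem pow_le (F : IdealFiltration R) (n k : ℕ) : F.I n ^ k ≤ F.I (n * k) := by
  induction k with
  | zero => simp [F.zero_eq_top]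
  | succ k ih =>
    rw [pow_succ, mul_add_one]
    exact (Ideal.mul_mono_left ih).trans (F.mul_le _ _)

/-- The `d`-th Veronese `n ↦ I_{dn}` of a filtration. -/
def veronese (F : IdealFiltration R) (d : ℕ) : IdealFiltration R where
  I n := F.I (d * n)
  zero_eq_top := by rw [mul_zero, F.zero_eq_top]
  antitone _ _ h := F.antitone (Nat.mul_le_mul_left d h)
  mul_le i j := by rw [mul_add]; exact F.mul_le _ _

/-- The inclusion of the `d`-th Veronese subring of the Rees algebra, `t ↦ t ^ d`. -/
noncomputable def veroneseHom (F : IdealFiltration R) {d : ℕ} (hd : 0 < d) :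
    (F.veronese d).rees →ₐ[R] F.rees :=
  ((Polynomial.expand R d).comp (F.veronese d).rees.val).codRestrict F.rees fun f n ↦ by
    change (Polynomial.expand R d (f : R[X])).coeff n ∈ _
    rw [Polynomial.coeff_expand hd]
    split_ifs with h
    · obtain ⟨k, rfl⟩ := h
      rw [Nat.mul_div_cancel_left _ hd]
      exact f.2 k
    · exact zero_mem _

theorem veroneseHom_isIntegral (F : IdealFiltration R) {d : ℕ} (hd : 0 < d) :
    (F.veroneseHom hd).toRingHom.IsIntegral := by
  let := (F.veroneseHom hd).toRingHom.toAlgebra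
  intro f
  rw [F.eq_sum_monomial f]
  -- The `d`-th power of `a tⁿ` is the image of `a ^ d tⁿ`, because `a ^ d ∈ I_{dn}`.
  refine IsIntegral.sum _ fun n _ ↦ IsIntegral.of_pow hd ?_
  have hmem : (f : R[X]).coeff n ^ d ∈ (F.veronese d).I n := by
    change _ ∈ F.I (d * n)
    rw [mul_comm]
    exact F.pow_le n d (Ideal.pow_mem_pow (f.2 n) d)
  convert! isIntegral_algebraMap (A := F.rees)
    (x := (⟨_, (F.veronese d).monomial_mem_rees hmem⟩ : (F.veronese d).rees))
  apply Subtype.ext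
  change _ = Polynomial.expand R d (Polynomial.monomial n _)
  rw [Polynomial.expand_monomial]
  simp [Polynomial.monomial_pow]

theorem analyticSpread_veronese [IsLocalRing R] (F : IdealFiltration R) {d : ℕ} (hd : 0 < d) :
    (F.veronese d).analyticSpread = F.analyticSpread := by
  have hcomap : (IsLocalRing.maximalIdeal R).map (algebraMap R (F.veronese d).rees) =
      ((IsLocalRing.maximalIdeal R).map (algebraMap R F.rees)).comap
        (F.veroneseHom hd).toRingHom := by
    ext f
    rw [Ideal.mem_comap, mem_map_algebraMap_rees_iff, mem_map_algebraMap_rees_iff]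
    change _ ↔ ∀ n, (Polynomial.expand R d (f : R[X])).coeff n ∈ _
    constructor
    · intro h n
      rw [Polynomial.coeff_expand hd]
      split_ifs with hn
      · obtain ⟨k, rfl⟩ := hn
        rw [Nat.mul_div_cancel_left _ hd]
        exact h k
      · exact zero_mem _
    · intro h n
      have := h (d * n)
      rwa [Polynomial.coeff_expand_mul' hd] at this
  rw [analyticSpread, analyticSpread, hcomap]
  exact (F.veroneseHom_isIntegral hd).ringKrullDim_quotient_comap _ _

/-- The `I`-adic filtration. -/
def adic (I : Ideal R) : IdealFiltration R where
  I n := I ^ n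
  zero_eq_top := by simp
  antitone := antitone_nat_of_succ_le fun n ↦ Ideal.pow_le_pow_right n.le_succ
  mul_le i j := (pow_add I i j).ge

theorem analyticSpread_adic [IsLocalRing R] (I : Ideal R) :
    (adic I).analyticSpread = I.analyticSpread := rfl

end IdealFiltration

/-! ### Noetherian filtrations: an adic Veronese -/

namespace IdealFiltration

variable {R : Type*} [CommRing R]

theorem IsNoetherianFiltration.exists_homogeneous_generators {F : IdealFiltration R}
    (hF : F.IsNoetherianFiltration) :
    ∃ G : Finset (ℕ × R), (∀ g ∈ G, 0 < g.1 ∧ g.2 ∈ F.I g.1) ∧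
      F.rees ≤ Algebra.adjoin R (Set.range fun g : G ↦ Polynomial.monomial g.1.1 g.1.2) := by
  classical
  obtain ⟨s, hs⟩ := F.rees.fg_top.mp hF.1
  have hsF : ∀ f ∈ s, f ∈ F.rees := fun f hf ↦ hs ▸ Algebra.subset_adjoin hf
  refine ⟨s.biUnion fun f ↦ (f.support.filter (0 < ·)).image fun n ↦ (n, f.coeff n), ?_, ?_⟩
  · rintro ⟨n, a⟩ h
    simp only [Finset.mem_biUnion, Finset.mem_image, Finset.mem_filter] at h
    obtain ⟨f, hf, k, ⟨-, hk⟩, h⟩ := h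
    obtain ⟨rfl, rfl⟩ := Prod.mk.inj h
    exact ⟨hk, hsF f hf k⟩
  · rw [← hs]
    refine Algebra.adjoin_le fun f hf ↦ ?_
    rw [SetLike.mem_coe, f.as_sum_support]
    refine sum_mem fun n hn ↦ ?_
    rcases n.eq_zero_or_pos with rfl | h0
    · exact Subalgebra.algebraMap_mem _ _
    · refine Algebra.subset_adjoin ⟨⟨(n, f.coeff n), ?_⟩, rfl⟩
      simp only [Finset.mem_biUnion, Finset.mem_image, Finset.mem_filter]
      exact ⟨f, hf, n, ⟨hn, h0⟩, rfl⟩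

theorem prod_pow_mem (F : IdealFiltration R) {ι : Type*} (t : Finset ι) (d : ι → ℕ) (a : ι → R)
    (ha : ∀ i, a i ∈ F.I (d i)) (s : ι → ℕ) :
    ∏ i ∈ t, a i ^ s i ∈ F.I (∑ i ∈ t, d i * s i) := by
  classical
  induction t using Finset.induction_on with
  | empty => simp [F.zero_eq_top]
  | insert i t hi ih =>
    rw [Finset.prod_insert hi, Finset.sum_insert hi]
    exact F.mul_le _ _ (Ideal.mul_mem_mul (F.pow_le _ _ (Ideal.pow_mem_pow (ha i) _)) ih)

theorem prod_pow_mem_mul (F : IdealFiltration R) {ι : Type*} [Fintype ι] (d : ι → ℕ) (a : ι → R)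
    (ha : ∀ i, a i ∈ F.I (d i)) {D : ℕ} (hD : 0 < D) (hdD : ∀ i, d i ∣ D) (s : ι → ℕ) {N : ℕ}
    (hs : ∑ i, d i * s i = D + N) (hN : Fintype.card ι * D ≤ D + N) :
    ∏ i, a i ^ s i ∈ F.I D * F.I N := by
  classical
  -- Pigeonhole: otherwise the total degree `D + N` would be less than `card ι * D`.
  obtain ⟨i, hi⟩ : ∃ i, D ≤ d i * s i := by
    by_contra! h
    rcases isEmpty_or_nonempty ι with hι | hι
    · rw [Finset.univ_eq_empty, Finset.sum_empty] at hs
      omega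
    · have := Finset.sum_lt_sum_of_nonempty (Finset.univ_nonempty (α := ι)) fun i _ ↦ h i
      rw [Finset.sum_const, Finset.card_univ, smul_eq_mul] at this
      omega
  obtain ⟨q, rfl⟩ := hdD i
  have hqs : q ≤ s i := Nat.le_of_mul_le_mul_left hi (Nat.pos_of_mul_pos_right hD)
  -- Split off `a i ^ q`, of degree exactly `D = d i * q`; the remaining factor has degree `N`.
  have hsplit : ∀ j, s j = (Pi.single i q : ι → ℕ) j + Function.update s i (s i - q) j := by
    intro j
    rcases eq_or_ne j i with rfl | hj
    · simp [hqs]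
    · simp [hj]
  have hprod : ∏ j, a j ^ s j = a i ^ q * ∏ j, a j ^ Function.update s i (s i - q) j := by
    rw [Finset.prod_congr rfl fun j _ ↦ by rw [hsplit j, pow_add], Finset.prod_mul_distrib]
    congr 1
    rw [Finset.prod_eq_single i] <;> simp +contextual
  have hsum : ∑ j, d j * Function.update s i (s i - q) j = N := by
    have h1 : ∑ j, d j * s j = d i * q + ∑ j, d j * Function.update s i (s i - q) j := by
      rw [Finset.sum_congr rfl fun j _ ↦ by rw [hsplit j, mul_add], Finset.sum_add_distrib]
      congr 1
      rw [Finset.sum_eq_single i] <;> simp +contextual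
    omega
  rw [hprod]
  refine Ideal.mul_mem_mul (F.pow_le _ _ (Ideal.pow_mem_pow (ha i) _)) ?_
  have := F.prod_pow_mem Finset.univ d a ha (Function.update s i (s i - q))
  rwa [hsum] at this

theorem I_add_le_mul (F : IdealFiltration R) {ι : Type*} [Fintype ι] (d : ι → ℕ) (a : ι → R)
    (ha : ∀ i, a i ∈ F.I (d i))
    (hgen : F.rees ≤ Algebra.adjoin R (Set.range fun i ↦ Polynomial.monomial (d i) (a i)))
    {D : ℕ} (hD : 0 < D) (hdD : ∀ i, d i ∣ D) {N : ℕ} (hN : Fintype.card ι * D ≤ D + N) :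
    F.I (D + N) ≤ F.I D * F.I N := by
  intro x hx
  have h := hgen (F.monomial_mem_rees hx)
  rw [Algebra.adjoin_range_eq_range_aeval] at h
  obtain ⟨p, hp⟩ := h
  have hx' := congr_arg (fun f : R[X] ↦ f.coeff (D + N)) hp
  simp only [Polynomial.coeff_monomial_same] at hx'
  rw [← hx']
  change Polynomial.coeff (MvPolynomial.aeval _ p) _ ∈ _
  rw [MvPolynomial.aeval_def, MvPolynomial.eval₂_eq', Polynomial.finsetSum_coeff]
  refine Ideal.sum_mem _ fun s _ ↦ ?_
  have hmon : ∏ i, (Polynomial.monomial (d i) (a i)) ^ s i =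
      Polynomial.monomial (∑ i, d i * s i) (∏ i, a i ^ s i) := by
    simp only [Polynomial.monomial_pow]
    generalize (Finset.univ : Finset ι) = t
    classical
    induction t using Finset.induction_on with
    | empty => simp
    | insert i t hi ih =>
      rw [Finset.prod_insert hi, Finset.prod_insert hi, Finset.sum_insert hi, ih,
        Polynomial.monomial_mul_monomial]
  rw [hmon, Polynomial.algebraMap_apply, Algebra.algebraMap_self_apply, Polynomial.C_mul_monomial,
    Polynomial.coeff_monomial]
  split_ifs with hs
  · exact Ideal.mul_mem_left _ _ (F.prod_pow_mem_mul d a ha hD hdD s hs hN)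
  · exact zero_mem _

/-- Some Veronese of a Noetherian filtration is an adic filtration. -/
theorem IsNoetherianFiltration.exists_I_mul_eq_pow {F : IdealFiltration R}
    (hF : F.IsNoetherianFiltration) :
    ∃ e, 0 < e ∧ ∀ m, F.I (e * m) = F.I e ^ m := by
  obtain ⟨G, hG, hgen⟩ := hF.exists_homogeneous_generators
  obtain ⟨D, hDdef⟩ : ∃ D, D = ∏ g : G, g.1.1 := ⟨_, rfl⟩
  have hD : 0 < D := hDdef ▸ Finset.prod_pos fun g _ ↦ (hG g g.2).1
  have hdD : ∀ g : G, g.1.1 ∣ D := fun g ↦ hDdef ▸ Finset.dvd_prod_of_mem _ (Finset.mem_univ g)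
  obtain ⟨r, hr⟩ : ∃ r, r = Fintype.card G := ⟨_, rfl⟩
  have step : ∀ k, F.I (D * k + D * (r + 1)) ≤ F.I D ^ k * F.I (D * (r + 1)) := by
    intro k
    induction k with
    | zero => simp
    | succ k ih =>
      rw [mul_add_one, add_comm _ D, add_assoc, pow_succ', mul_assoc]
      refine (F.I_add_le_mul (fun g : G ↦ g.1.1) (fun g ↦ g.1.2) (fun g ↦ (hG g g.2).2) hgen hD hdD
        ?_).trans (Ideal.mul_mono_right ih)
      rw [← hr]
      nlinarith
  -- The factor `r + 1` puts degrees in the range where `I_D` splits off, and keeps `e` positive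
  -- when there are no generators.
  refine ⟨D * (r + 1), by positivity, fun m ↦ le_antisymm ?_ (F.pow_le _ m)⟩
  cases m with
  | zero => simp
  | succ m =>
    have h := step ((r + 1) * m)
    rw [← mul_assoc, ← mul_add_one] at h
    refine h.trans ?_
    rw [pow_mul, pow_succ (F.I (D * (r + 1)))]
    exact Ideal.mul_mono_left (Ideal.pow_right_mono (F.pow_le _ _) m)

theorem IsNoetherianFiltration.exists_analyticSpread_eq [IsLocalRing R] {F : IdealFiltration R}
    (hF : F.IsNoetherianFiltration) :
    ∃ e, 0 < e ∧ ∀ m, 0 < m → (F.I (e * m)).analyticSpread = F.analyticSpread := by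
  obtain ⟨e, he, h⟩ := hF.exists_I_mul_eq_pow
  refine ⟨e, he, fun m hm ↦ ?_⟩
  rw [← F.analyticSpread_veronese (Nat.mul_pos he hm), ← analyticSpread_adic]
  congr 1
  rw [adic, veronese]
  congr 1
  funext n
  rw [h, ← pow_mul, ← h, mul_assoc]

end IdealFiltration

/-! ### Dimension of algebraic extensions of finite type -/

theorem Algebra.exists_surjective_polynomial_adjoin_singleton {A B : Type*} [CommRing A]
    [CommRing B] [Algebra A B] (x : B) :
    ∃ f : A[X] →ₐ[A] Algebra.adjoin A {x}, Function.Surjective f ∧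
      ∀ p, (f p : B) = Polynomial.aeval x p := by
  refine ⟨Polynomial.aeval ⟨x, Algebra.self_mem_adjoin_singleton A x⟩, ?_,
    fun p ↦ Polynomial.aeval_subalgebra_coe _ _ _⟩
  rintro ⟨y, hy⟩
  obtain ⟨p, rfl⟩ := (Algebra.adjoin_singleton_eq_range_aeval A x).le hy
  exact ⟨p, Subtype.ext (Polynomial.aeval_subalgebra_coe _ _ _)⟩

/-- `A[x]` is a quotient of `A[X]` killing a nonzero polynomial, a nonzerodivisor, which costs the
dimension gained by adding a variable. -/
theorem ringKrullDim_adjoin_singleton_le {A B : Type*} [CommRing A] [IsDomain A]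
    [IsNoetherianRing A] [CommRing B] [Algebra A B] {x : B} (hx : IsAlgebraic A x) :
    ringKrullDim (Algebra.adjoin A {x}) ≤ ringKrullDim A := by
  obtain ⟨p, hp, hpx⟩ := hx
  obtain ⟨f, hf, hfx⟩ := Algebra.exists_surjective_polynomial_adjoin_singleton (A := A) x
  have hfp : f p = 0 := Subtype.ext ((hfx p).trans hpx)
  have h := ringKrullDim_succ_le_of_surjective (f : A[X] →+* Algebra.adjoin A {x}) hf
    (mem_nonZeroDivisors_of_ne_zero hp) hfp
  rw [Polynomial.ringKrullDim_of_isNoetherianRing] at h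
  exact ENat.WithBot.add_le_add_one_right_iff.mp h

theorem ringKrullDim_adjoin_finset_le {A B : Type*} [CommRing A] [IsDomain A]
    [IsNoetherianRing A] [CommRing B] [IsDomain B] [Algebra A B] [FaithfulSMul A B] (s : Finset B)
    (hs : ∀ x ∈ s, IsAlgebraic A x) :
    ringKrullDim (Algebra.adjoin A (s : Set B)) ≤ ringKrullDim A := by
  classical
  induction s using Finset.induction_on with
  | empty =>
    rw [Finset.coe_empty, Algebra.adjoin_empty]
    exact (ringKrullDim_eq_of_ringEquiv
      (Algebra.botEquivOfInjective (FaithfulSMul.algebraMap_injective A B)).toRingEquiv).le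
  | insert x s hxs ih =>
    have hx : IsAlgebraic (Algebra.adjoin A (s : Set B)) x :=
      (hs x (Finset.mem_insert_self _ _)).extendScalars
        (FaithfulSMul.algebraMap_injective A (Algebra.adjoin A (s : Set B)))
    have : Algebra.FiniteType A (Algebra.adjoin A (s : Set B)) :=
      (Subalgebra.fg_iff_finiteType _).mp (Subalgebra.fg_adjoin_finset s)
    have : IsNoetherianRing (Algebra.adjoin A (s : Set B)) :=
      Algebra.FiniteType.isNoetherianRing A _
    rw [Finset.coe_insert, ← Set.union_singleton, Algebra.adjoin_union_eq_adjoin_adjoin]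
    exact (ringKrullDim_adjoin_singleton_le hx).trans
      (ih fun y hy ↦ hs y (Finset.mem_insert_of_mem hy))

theorem Algebra.IsAlgebraic.ringKrullDim_le_of_finiteType {A B : Type*} [CommRing A] [IsDomain A]
    [IsNoetherianRing A] [CommRing B] [IsDomain B] [Algebra A B] [FaithfulSMul A B]
    [Algebra.FiniteType A B] [Algebra.IsAlgebraic A B] : ringKrullDim B ≤ ringKrullDim A := by
  obtain ⟨s, hs⟩ := ‹Algebra.FiniteType A B›.1
  rw [← ringKrullDim_eq_of_ringEquiv (Subalgebra.topEquiv (R := A) (A := B)).toRingEquiv, ← hs]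
  exact ringKrullDim_adjoin_finset_le s fun x _ ↦ Algebra.IsAlgebraic.isAlgebraic x

theorem ringKrullDim_le_of_forall_minimalPrimes {A : Type*} [CommRing A] {n : WithBot ℕ∞}
    (h : ∀ q ∈ minimalPrimes A, ringKrullDim (A ⧸ q) ≤ n) : ringKrullDim A ≤ n := by
  refine iSup_le fun l ↦ ?_
  obtain ⟨q, hq, hql⟩ := Ideal.exists_minimalPrimes_le (J := l.head.1) bot_le
  refine le_trans ?_ (h q hq)
  rw [ringKrullDim_quotient]
  let l' : LTSeries (PrimeSpectrum.zeroLocus (q : Set A)) :=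
    { length := l.length
      toFun i := ⟨l i, fun _ hx ↦ l.head_le i (hql hx)⟩
      step i := l.step i }
  exact Order.LTSeries.length_le_krullDim l'

/-! ### The extended Rees algebra and its dimension -/

open LaurentPolynomial

theorem Polynomial.coeff_toLaurent_natCast {R : Type*} [Semiring R] (f : R[X]) (n : ℕ) :
    f.toLaurent.coeff (n : ℤ) = f.coeff n := by
  rw [LaurentPolynomial.coeff_toLaurent]
  exact Finsupp.mapDomain_apply Nat.cast_injective _ _

theorem Polynomial.coeff_toLaurent_of_neg {R : Type*} [Semiring R] (f : R[X]) {n : ℤ} (hn : n < 0) :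
    f.toLaurent.coeff n = 0 := by
  rw [LaurentPolynomial.coeff_toLaurent]
  refine Finsupp.mapDomain_of_notMem_range _ _ ?_
  rintro ⟨k, rfl⟩
  exact absurd hn (not_lt.mpr (Int.natCast_nonneg k))

namespace IdealFiltration

variable {R : Type*} [CommRing R]

/-- The extended Rees algebra `R[𝓘, t⁻¹]` of a filtration, as a subalgebra of `R[t, t⁻¹]`. -/
def extendedRees (F : IdealFiltration R) : Subalgebra R R[T;T⁻¹] where
  carrier := { f | ∀ n : ℤ, f.coeff n ∈ F.I n.toNat }
  mul_mem' {f g} hf hg n := by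
    rw [AddMonoidAlgebra.coeff_mul]
    refine Ideal.sum_mem _ fun i _ ↦ Ideal.sum_mem _ fun j _ ↦ ?_
    dsimp only
    split_ifs with h
    · subst h
      -- `Int.toNat` is subadditive, so truncating negative degrees to `I 0 = ⊤` respects products.
      exact F.antitone (by omega) (F.mul_le _ _ (Ideal.mul_mem_mul (hf i) (hg j)))
    · exact zero_mem _
  add_mem' {f g} hf hg n := by
    rw [AddMonoidAlgebra.coeff_add]
    exact add_mem (hf n) (hg n)
  algebraMap_mem' r n := by
    rw [← C_eq_algebraMap, C_apply]
    split_ifs with h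
    · subst h
      simp [F.zero_eq_top]
    · exact zero_mem _

theorem single_mem_extendedRees (F : IdealFiltration R) {n : ℤ} {a : R} (ha : a ∈ F.I n.toNat) :
    AddMonoidAlgebra.single n a ∈ F.extendedRees := by
  intro k
  rw [AddMonoidAlgebra.coeff_single, Finsupp.single_apply]
  split_ifs with h
  · exact h ▸ ha
  · exact zero_mem _

theorem eq_sum_single (F : IdealFiltration R) (f : F.extendedRees) :
    f = ∑ n ∈ (f : R[T;T⁻¹]).coeff.support, ⟨_, F.single_mem_extendedRees (f.2 n)⟩ := by
  apply Subtype.ext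
  rw [AddSubmonoidClass.coe_finsetSum]
  exact (AddMonoidAlgebra.sum_coeff_single (f : R[T;T⁻¹])).symm

theorem extendedRees_induction (F : IdealFiltration R) {motive : F.extendedRees → Prop}
    (zero : motive 0) (add : ∀ x y, motive x → motive y → motive (x + y))
    (single : ∀ (n : ℤ) (a : R) (ha : a ∈ F.I n.toNat),
      motive ⟨_, F.single_mem_extendedRees ha⟩) (f : F.extendedRees) : motive f := by
  rw [F.eq_sum_single f]
  exact Finset.sum_induction _ _ add zero fun n _ ↦ single n _ (f.2 n)

/-- The element `t⁻¹` of the extended Rees algebra. -/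
noncomputable def tInv (F : IdealFiltration R) : F.extendedRees :=
  ⟨T (-1), F.single_mem_extendedRees (by simp [F.zero_eq_top])⟩

theorem coeff_tInv_mul (F : IdealFiltration R) (f : F.extendedRees) (n : ℤ) :
    (F.tInv * f : R[T;T⁻¹]).coeff n = (f : R[T;T⁻¹]).coeff (n + 1) := by
  change (AddMonoidAlgebra.single (-1) (1 : R) * (f : R[T;T⁻¹])).coeff n = _
  rw [AddMonoidAlgebra.coeff_single_mul_apply, one_mul]
  congr 1
  ring

theorem tInv_mem_nonZeroDivisors (F : IdealFiltration R) :
    F.tInv ∈ nonZeroDivisors F.extendedRees := by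
  rw [mem_nonZeroDivisors_iff_right]
  intro x hx
  apply Subtype.ext
  have := congr_arg Subtype.val hx
  rw [MulMemClass.coe_mul] at this
  exact (isUnit_T (-1)).mul_left_eq_zero.mp this

/-- The inclusion of the Rees algebra into the extended Rees algebra. -/
noncomputable def toExtendedRees (F : IdealFiltration R) : F.rees →ₐ[R] F.extendedRees :=
  (Polynomial.toLaurentAlg.comp F.rees.val).codRestrict F.extendedRees fun f n ↦ by
    change (Polynomial.toLaurent (f : R[X])).coeff n ∈ _
    rcases lt_or_ge n 0 with hn | hn
    · rw [Polynomial.coeff_toLaurent_of_neg _ hn]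
      exact zero_mem _
    · lift n to ℕ using hn
      rw [Polynomial.coeff_toLaurent_natCast]
      exact f.2 n

theorem coe_toExtendedRees (F : IdealFiltration R) (f : F.rees) :
    (F.toExtendedRees f : R[T;T⁻¹]) = Polynomial.toLaurent (f : R[X]) := rfl

theorem single_natCast_eq_toExtendedRees (F : IdealFiltration R) (n : ℕ) {a : R}
    (ha : a ∈ F.I (n : ℤ).toNat) :
    (⟨_, F.single_mem_extendedRees ha⟩ : F.extendedRees) =
      F.toExtendedRees ⟨_, F.monomial_mem_rees (n := n) (a := a) ha⟩ := by
  apply Subtype.ext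
  rw [coe_toExtendedRees]
  dsimp only
  rw [single_eq_C_mul_T, ← Polynomial.C_mul_X_pow_eq_monomial, Polynomial.toLaurent_C_mul_X_pow]

theorem tInv_pow_mul_single (F : IdealFiltration R) (k : ℕ) (n : ℤ) {a : R}
    (ha : a ∈ F.I n.toNat) (ha' : a ∈ F.I (n - k).toNat) :
    F.tInv ^ k * ⟨_, F.single_mem_extendedRees ha⟩ = ⟨_, F.single_mem_extendedRees ha'⟩ := by
  apply Subtype.ext
  rw [MulMemClass.coe_mul, SubmonoidClass.coe_pow, tInv, T_pow, T, AddMonoidAlgebra.single_mul_single]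
  dsimp only
  congr 1
  · ring
  · ring

theorem single_neg_eq (F : IdealFiltration R) (n : ℕ) {a : R} (ha : a ∈ F.I (-(n : ℤ)).toNat) :
    (⟨_, F.single_mem_extendedRees ha⟩ : F.extendedRees) =
      F.tInv ^ n * algebraMap R _ a := by
  have h0 : a ∈ F.I (0 : ℤ).toNat := by simp [F.zero_eq_top]
  have h0' : a ∈ F.I (0 - (n : ℤ)).toNat := by simpa using ha
  have := F.tInv_pow_mul_single n 0 h0 h0'
  rw [show algebraMap R F.extendedRees a = ⟨_, F.single_mem_extendedRees h0⟩ from rfl, this]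
  simp

theorem exists_eq_toExtendedRees_add_tInv_mul (F : IdealFiltration R) (f : F.extendedRees) :
    ∃ (s : F.rees) (g : F.extendedRees), f = F.toExtendedRees s + F.tInv * g := by
  induction f using F.extendedRees_induction with
  | zero => exact ⟨0, 0, by simp⟩
  | add x y hx hy =>
    obtain ⟨s, g, rfl⟩ := hx
    obtain ⟨s', g', rfl⟩ := hy
    exact ⟨s + s', g + g', by rw [map_add]; ring⟩
  | single n a ha =>
    obtain ⟨k, rfl | rfl⟩ := n.eq_nat_or_neg
    · exact ⟨_, 0, by rw [mul_zero, add_zero]; exact F.single_natCast_eq_toExtendedRees k ha⟩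
    · rw [F.single_neg_eq k ha]
      cases k with
      | zero => exact ⟨algebraMap R _ a, 0, by simp⟩
      | succ k => exact ⟨0, F.tInv ^ k * algebraMap R _ a, by rw [map_zero, zero_add, pow_succ']; ring⟩

/-- Clearing denominators: this makes `E` algebraic over `R[t⁻¹]` modulo any prime that avoids
`t⁻¹`. -/
theorem exists_tInv_pow_mul_mem_adjoin (F : IdealFiltration R) (f : F.extendedRees) :
    ∃ k, F.tInv ^ k * f ∈ Algebra.adjoin R {F.tInv} := by
  have hu : F.tInv ∈ Algebra.adjoin R {F.tInv} := Algebra.subset_adjoin rfl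
  induction f using F.extendedRees_induction with
  | zero => exact ⟨0, by simp⟩
  | add x y hx hy =>
    obtain ⟨k, hk⟩ := hx
    obtain ⟨l, hl⟩ := hy
    refine ⟨k + l, ?_⟩
    rw [mul_add, pow_add, mul_right_comm, mul_assoc _ _ y]
    exact add_mem (mul_mem hk (pow_mem hu _)) (mul_mem (pow_mem hu _) hl)
  | single n a ha =>
    obtain ⟨k, rfl | rfl⟩ := n.eq_nat_or_neg
    · refine ⟨k, ?_⟩
      have h0 : a ∈ F.I ((k : ℤ) - k).toNat := by simp [F.zero_eq_top]
      rw [F.tInv_pow_mul_single k k ha h0]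
      convert! Subalgebra.algebraMap_mem (Algebra.adjoin R {F.tInv}) a using 1
      apply Subtype.ext
      dsimp only
      rw [sub_self]
      rfl
    · refine ⟨0, ?_⟩
      rw [pow_zero, one_mul, F.single_neg_eq k ha]
      exact mul_mem (pow_mem hu _) (Subalgebra.algebraMap_mem _ _)

theorem range_toExtendedRees_sup_adjoin (F : IdealFiltration R) :
    F.toExtendedRees.range ⊔ Algebra.adjoin R {F.tInv} = ⊤ := by
  rw [eq_top_iff]
  rintro f -
  have hu : F.tInv ∈ F.toExtendedRees.range ⊔ Algebra.adjoin R {F.tInv} :=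
    (le_sup_right : Algebra.adjoin R {F.tInv} ≤ _) (Algebra.self_mem_adjoin_singleton R F.tInv)
  induction f using F.extendedRees_induction with
  | zero => exact zero_mem _
  | add x y hx hy => exact add_mem hx hy
  | single n a ha =>
    obtain ⟨k, rfl | rfl⟩ := n.eq_nat_or_neg
    · rw [F.single_natCast_eq_toExtendedRees k ha]
      exact (le_sup_left : F.toExtendedRees.range ≤ _) (AlgHom.mem_range_self _ _)
    · rw [F.single_neg_eq k ha]
      exact mul_mem (pow_mem hu _) (Subalgebra.algebraMap_mem _ _)

theorem IsNoetherianFiltration.finiteType_extendedRees {F : IdealFiltration R}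
    (hF : F.IsNoetherianFiltration) : Algebra.FiniteType R F.extendedRees := by
  refine ⟨?_⟩
  rw [← F.range_toExtendedRees_sup_adjoin, ← Algebra.map_top]
  exact (hF.1.map _).sup (by
    simpa using Subalgebra.fg_adjoin_finset (R := R) {F.tInv})

theorem IsNoetherianFiltration.ringKrullDim_extendedRees_le [IsNoetherianRing R]
    {F : IdealFiltration R} (hF : F.IsNoetherianFiltration) :
    ringKrullDim F.extendedRees ≤ ringKrullDim R + 1 := by
  refine ringKrullDim_le_of_forall_minimalPrimes fun q hq ↦ ?_
  have := hq.1.1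
  -- Minimal primes contain no nonzerodivisors.
  have hu : F.tInv ∉ q := fun h ↦
    Set.disjoint_left.mp (Ideal.disjoint_nonZeroDivisors_of_mem_minimalPrimes hq) h
      F.tInv_mem_nonZeroDivisors
  have := hF.finiteType_extendedRees
  let π : F.extendedRees →ₐ[R] F.extendedRees ⧸ q := Ideal.Quotient.mkₐ R q
  have hu' : π F.tInv ≠ 0 := by rwa [ne_eq, Ideal.Quotient.mkₐ_eq_mk, Ideal.Quotient.eq_zero_iff_mem]
  let A := Algebra.adjoin R {π F.tInv}
  obtain ⟨φ, hφ, -⟩ := Algebra.exists_surjective_polynomial_adjoin_singleton (A := R) (π F.tInv)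
  have hAdim : ringKrullDim A ≤ ringKrullDim R + 1 := by
    rw [← Polynomial.ringKrullDim_of_isNoetherianRing]
    exact ringKrullDim_le_of_surjective (φ : R[X] →+* A) hφ
  have : IsNoetherianRing A := isNoetherianRing_of_surjective _ _ (φ : R[X] →+* A) hφ
  have huA : π F.tInv ∈ A := Algebra.self_mem_adjoin_singleton R (π F.tInv)
  have : Algebra.FiniteType R (F.extendedRees ⧸ q) :=
    Algebra.FiniteType.of_surjective π Ideal.Quotient.mk_surjective
  have : Algebra.FiniteType A (F.extendedRees ⧸ q) := .of_restrictScalars_finiteType R _ _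
  have : Algebra.IsAlgebraic A (F.extendedRees ⧸ q) := by
    refine ⟨fun b ↦ ?_⟩
    obtain ⟨f, rfl⟩ := Ideal.Quotient.mk_surjective b
    obtain ⟨k, hk⟩ := F.exists_tInv_pow_mul_mem_adjoin f
    have hk' : π F.tInv ^ k * π f ∈ A := by
      have h := Subalgebra.mem_map (f := π).mpr ⟨_, hk, rfl⟩
      rwa [AlgHom.map_adjoin_singleton, map_mul, map_pow] at h
    -- With `u` the class of `t⁻¹`, the class `b` of `f` is a root of `u ^ k X - u ^ k b`, whose
    -- leading coefficient is nonzero.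
    refine ⟨Polynomial.C ((⟨_, huA⟩ : A) ^ k) * Polynomial.X - Polynomial.C ⟨_, hk'⟩, fun h ↦ ?_, ?_⟩
    · have h1 : (⟨_, huA⟩ : A) ^ k = 0 := by
        simpa [Polynomial.coeff_C] using congr_arg (fun p : A[X] ↦ p.coeff 1) h
      exact hu' (congr_arg Subtype.val (eq_zero_of_pow_eq_zero h1))
    · rw [map_sub, map_mul, Polynomial.aeval_C, Polynomial.aeval_C, Polynomial.aeval_X, sub_eq_zero]
      rfl
  exact Algebra.IsAlgebraic.ringKrullDim_le_of_finiteType.trans hAdim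

end IdealFiltration

/-! ### Comparing quotients, and the dimension inequality for fibres -/

theorem ringKrullDim_quotient_eq_of_ker_eq {A B : Type*} [CommRing A] [CommRing B]
    (f : A →+* B) (hf : Function.Surjective f) {I : Ideal A} (hI : RingHom.ker f = I) :
    ringKrullDim (A ⧸ I) = ringKrullDim B :=
  hI ▸ ringKrullDim_eq_of_ringEquiv (RingHom.quotientKerEquivOfSurjective hf)

theorem ringKrullDim_quotient_le_of_forall_exists_sub_mem {A B : Type*} [CommRing A] [CommRing B]
    (f : A →+* B) {I : Ideal A} {K : Ideal B} (hf : ∀ b, ∃ a, f a - b ∈ K) (hI : I ≤ K.comap f) :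
    ringKrullDim (B ⧸ K) ≤ ringKrullDim (A ⧸ I) := by
  refine ringKrullDim_le_of_surjective (Ideal.quotientMap K f hI) fun x ↦ ?_
  obtain ⟨b, rfl⟩ := Ideal.Quotient.mk_surjective x
  obtain ⟨a, ha⟩ := hf b
  exact ⟨Ideal.Quotient.mk I a, (Ideal.Quotient.mk_eq_mk_iff_sub_mem _ _).mpr ha⟩

theorem ringKrullDim_quotient_eq_of_forall_exists_sub_mem {A B : Type*} [CommRing A] [CommRing B]
    (f : A →+* B) {I : Ideal A} {K : Ideal B} (hf : ∀ b, ∃ a, f a - b ∈ K) (hI : I = K.comap f) :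
    ringKrullDim (A ⧸ I) = ringKrullDim (B ⧸ K) := by
  refine ringKrullDim_eq_of_ringEquiv (RingEquiv.ofBijective (Ideal.quotientMap K f hI.le)
    ⟨Ideal.quotientMap_injective' hI.ge, fun x ↦ ?_⟩)
  obtain ⟨b, rfl⟩ := Ideal.Quotient.mk_surjective x
  obtain ⟨a, ha⟩ := hf b
  exact ⟨Ideal.Quotient.mk I a, (Ideal.Quotient.mk_eq_mk_iff_sub_mem _ _).mpr ha⟩

theorem Ideal.map_quotientMk_ne_top {A : Type*} [CommRing A] {I P : Ideal A} (hP : P ≠ ⊤)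
    (h : I ≤ P) : P.map (Ideal.Quotient.mk I) ≠ ⊤ := by
  intro htop
  apply hP
  rw [← Ideal.comap_map_mk h, htop, Ideal.comap_top]

/-- The inequality `ht M' ≤ ht m' + ht (M'/m'B')` for the Noetherian map `A/J → B/U`, with both
right-hand heights bounded by dimensions. -/
theorem Ideal.height_map_quotientMk_le {A B : Type*} [CommRing A] [CommRing B] [Algebra A B]
    [IsNoetherianRing A] [IsNoetherianRing B] {J m : Ideal A} {U M : Ideal B} [hm : m.IsPrime]
    [hM : M.IsPrime] [M.LiesOver m] (hJU : J ≤ U.comap (algebraMap A B)) (hUM : U ≤ M) :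
    ((M.map (Ideal.Quotient.mk U)).height : WithBot ℕ∞) ≤
      ringKrullDim (A ⧸ J) + ringKrullDim (B ⧸ U ⊔ m.map (algebraMap A B)) := by
  have hJm : J ≤ m := by
    rw [Ideal.over_def M m]
    exact hJU.trans (Ideal.comap_mono hUM)
  let _ : Algebra (A ⧸ J) (B ⧸ U) := Ideal.Quotient.algebraQuotientOfLEComap hJU
  have hmk : ∀ r, algebraMap (A ⧸ J) (B ⧸ U) (Ideal.Quotient.mk J r) =
    Ideal.Quotient.mk U (algebraMap A B r) := fun _ ↦ rfl
  let M' := M.map (Ideal.Quotient.mk U)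
  let m' := m.map (Ideal.Quotient.mk J)
  have : M'.IsPrime := Ideal.map_isPrime_of_surjective Ideal.Quotient.mk_surjective
    (by rwa [Ideal.mk_ker])
  have : m'.IsPrime := Ideal.map_isPrime_of_surjective Ideal.Quotient.mk_surjective
    (by rwa [Ideal.mk_ker])
  have : M'.LiesOver m' := by
    refine ⟨?_⟩
    ext x
    obtain ⟨r, rfl⟩ := Ideal.Quotient.mk_surjective x
    rw [Ideal.mem_quotient_iff_mem hJm, Ideal.mem_under, hmk, Ideal.mem_quotient_iff_mem hUM]
    exact Ideal.mem_of_liesOver M m r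
  have hle : m'.map (algebraMap (A ⧸ J) (B ⧸ U)) ≤ M' :=
    Ideal.map_le_iff_le_comap.mpr (Ideal.over_def M' m').le
  refine (WithBot.coe_le_coe.mpr (Ideal.height_le_height_add_of_liesOver m' M')).trans ?_
  rw [WithBot.coe_add]
  refine add_le_add Ideal.height_le_ringKrullDim_of_isPrime
    ((Ideal.height_le_ringKrullDim_of_ne_top (Ideal.map_quotientMk_ne_top
      (Ideal.IsPrime.ne_top ‹_›) hle)).trans ?_)
  refine ringKrullDim_le_of_surjective (Ideal.Quotient.lift _ ((Ideal.Quotient.mk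
    (m'.map (algebraMap (A ⧸ J) (B ⧸ U)))).comp (Ideal.Quotient.mk U)) fun b hb ↦ ?_)
    (Ideal.Quotient.lift_surjective_of_surjective _ _
      (Ideal.Quotient.mk_surjective.comp Ideal.Quotient.mk_surjective))
  suffices h : U ⊔ m.map (algebraMap A B) ≤ RingHom.ker ((Ideal.Quotient.mk
    (m'.map (algebraMap (A ⧸ J) (B ⧸ U)))).comp (Ideal.Quotient.mk U)) from h hb
  refine sup_le (fun u hu ↦ ?_) (Ideal.map_le_iff_le_comap.mpr fun a ha ↦ ?_)
  · rw [RingHom.mem_ker, RingHom.comp_apply, Ideal.Quotient.eq_zero_iff_mem.mpr hu, map_zero]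
  · rw [Ideal.mem_comap, RingHom.mem_ker, RingHom.comp_apply, ← hmk, Ideal.Quotient.eq_zero_iff_mem]
    exact Ideal.mem_map_of_mem _ (Ideal.mem_map_of_mem _ ha)

/-! ### The fibre modulo `t⁻¹` and the two bounds on the spread -/

namespace IdealFiltration

variable {R : Type*} [CommRing R]

theorem coeff_mem_of_mem_map_extendedRees (F : IdealFiltration R) (a : Ideal R) {f : F.extendedRees}
    (hf : f ∈ a.map (algebraMap R F.extendedRees)) (n : ℤ) :
    (f : R[T;T⁻¹]).coeff n ∈ a * F.I n.toNat := by
  induction hf using Submodule.span_induction generalizing n with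
  | mem x hx =>
    obtain ⟨r, hr, rfl⟩ := hx
    rw [Subalgebra.coe_algebraMap, ← C_eq_algebraMap, C_apply]
    split_ifs with h
    · subst h
      simpa [F.zero_eq_top] using hr
    · exact zero_mem _
  | zero => exact zero_mem _
  | add x y _ _ hx hy => exact add_mem (hx n) (hy n)
  | smul x y _ hy =>
    rw [smul_eq_mul, MulMemClass.coe_mul, AddMonoidAlgebra.coeff_mul]
    refine Ideal.sum_mem _ fun i _ ↦ Ideal.sum_mem _ fun j _ ↦ ?_
    dsimp only
    split_ifs with h
    · subst h
      have hle : F.I i.toNat * F.I j.toNat ≤ F.I (i + j).toNat :=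
        (F.mul_le _ _).trans (F.antitone (by omega))
      refine Ideal.mul_mono_right hle ?_
      rw [mul_left_comm]
      exact Ideal.mul_mem_mul (x.2 i) (hy j)
    · exact zero_mem _

theorem coeff_mem_of_mem_span_tInv_sup_map (F : IdealFiltration R) (a : Ideal R)
    {f : F.extendedRees}
    (hf : f ∈ Ideal.span {F.tInv} ⊔ a.map (algebraMap R F.extendedRees)) (n : ℕ) :
    (f : R[T;T⁻¹]).coeff n ∈ F.I (n + 1) ⊔ a * F.I n := by
  obtain ⟨x, hx, y, hy, rfl⟩ := Submodule.mem_sup.mp hf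
  obtain ⟨g, rfl⟩ := Ideal.mem_span_singleton.mp hx
  have hg : (F.tInv * g : R[T;T⁻¹]).coeff n ∈ F.I (n + 1) := by
    rw [F.coeff_tInv_mul]
    exact g.2 (n + 1)
  exact Submodule.add_mem_sup hg (F.coeff_mem_of_mem_map_extendedRees a hy n)

theorem exists_toExtendedRees_sub_mem (F : IdealFiltration R) (a : Ideal R) (f : F.extendedRees) :
    ∃ s, F.toExtendedRees.toRingHom s - f ∈
      Ideal.span {F.tInv} ⊔ a.map (algebraMap R F.extendedRees) := by
  obtain ⟨s, g, rfl⟩ := F.exists_eq_toExtendedRees_add_tInv_mul f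
  refine ⟨s, Ideal.mem_sup_left (Ideal.mem_span_singleton.mpr ⟨-g, ?_⟩)⟩
  rw [AlgHom.toRingHom_eq_coe, RingHom.coe_coe]
  ring

theorem map_le_comap_toExtendedRees (F : IdealFiltration R) (a : Ideal R) :
    a.map (algebraMap R F.rees) ≤ (Ideal.span {F.tInv} ⊔
      a.map (algebraMap R F.extendedRees)).comap F.toExtendedRees.toRingHom := by
  rw [Ideal.map_le_iff_le_comap]
  intro r hr
  rw [Ideal.mem_comap, Ideal.mem_comap, AlgHom.toRingHom_eq_coe, RingHom.coe_coe, AlgHom.commutes]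
  exact Ideal.mem_sup_right (Ideal.mem_map_of_mem _ hr)

/-- Modulo `t⁻¹` the degree-`n` part loses `I (n + 1)`; the hypothesis says that `a` already kills
it. -/
theorem map_eq_comap_toExtendedRees (F : IdealFiltration R) (a : Ideal R)
    (h : ∀ n, F.I (n + 1) ≤ a * F.I n) :
    a.map (algebraMap R F.rees) = (Ideal.span {F.tInv} ⊔
      a.map (algebraMap R F.extendedRees)).comap F.toExtendedRees.toRingHom := by
  refine le_antisymm (F.map_le_comap_toExtendedRees a) fun f hf ↦ ?_
  refine (F.mem_map_algebraMap_rees_iff a).mpr fun n ↦ ?_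
  have := F.coeff_mem_of_mem_span_tInv_sup_map a hf n
  rw [AlgHom.toRingHom_eq_coe, RingHom.coe_coe, coe_toExtendedRees,
    Polynomial.coeff_toLaurent_natCast, sup_eq_right.mpr (h n)] at this
  exact this

/-- The prime ideal `p R[t, t⁻¹] ∩ R[𝓘, t⁻¹]` of the extended Rees algebra. -/
noncomputable def extendedReesPrime (F : IdealFiltration R) (p : Ideal R) : Ideal F.extendedRees :=
  RingHom.ker ((AddMonoidAlgebra.mapRingHom ℤ (Ideal.Quotient.mk p)).comp
    (F.extendedRees.val : F.extendedRees →+* R[T;T⁻¹]))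

theorem mem_extendedReesPrime (F : IdealFiltration R) (p : Ideal R) {f : F.extendedRees} :
    f ∈ F.extendedReesPrime p ↔ ∀ n, (f : R[T;T⁻¹]).coeff n ∈ p := by
  rw [extendedReesPrime, RingHom.mem_ker]
  constructor
  · intro h n
    have := congr_arg (fun g : (R ⧸ p)[T;T⁻¹] ↦ g.coeff n) h
    rw [← Ideal.Quotient.eq_zero_iff_mem]
    simpa using this
  · intro h
    ext n
    simpa [Ideal.Quotient.eq_zero_iff_mem] using h n

instance extendedReesPrime_isPrime (F : IdealFiltration R) (p : Ideal R) [p.IsPrime] :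
    (F.extendedReesPrime p).IsPrime := RingHom.ker_isPrime _

theorem under_extendedReesPrime (F : IdealFiltration R) (p : Ideal R) :
    (F.extendedReesPrime p).under R = p := by
  ext r
  rw [Ideal.mem_under, mem_extendedReesPrime]
  simp only [Subalgebra.coe_algebraMap, ← C_eq_algebraMap, C_apply]
  refine ⟨fun h ↦ by simpa using h 0, fun h n ↦ ?_⟩
  split_ifs
  · exact h
  · exact zero_mem _

theorem extendedReesPrime_mono (F : IdealFiltration R) {p q : Ideal R} (h : p ≤ q) :
    F.extendedReesPrime p ≤ F.extendedReesPrime q := fun _ hf ↦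
  (F.mem_extendedReesPrime q).mpr fun n ↦ h ((F.mem_extendedReesPrime p).mp hf n)

/-- Contraction to `R` recovers `q` from `extendedReesPrime q`, so chains below `p` stay strict. -/
theorem height_le_height_extendedReesPrime (F : IdealFiltration R) (p : Ideal R) [hp : p.IsPrime] :
    p.height ≤ (F.extendedReesPrime p).height := by
  let φ : PrimeSpectrum R → PrimeSpectrum F.extendedRees := fun q ↦
    ⟨F.extendedReesPrime q.asIdeal, inferInstance⟩
  have hφ : StrictMono φ := by
    intro p q hpq
    refine lt_of_le_of_ne (F.extendedReesPrime_mono hpq.le) fun h ↦ hpq.ne (PrimeSpectrum.ext ?_)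
    rw [← F.under_extendedReesPrime p.asIdeal, ← F.under_extendedReesPrime q.asIdeal]
    exact congr_arg (fun P : PrimeSpectrum F.extendedRees ↦ P.asIdeal.under R) h
  have := Order.height_le_height_apply_of_strictMono φ hφ ⟨p, hp⟩
  rwa [← PrimeSpectrum.height_eq_orderHeight, ← PrimeSpectrum.height_eq_orderHeight] at this

theorem isNoetherianFiltration_adic [IsNoetherianRing R] (J : Ideal R) : (adic J).IsNoetherianFiltration :=
  inferInstanceAs (Algebra.FiniteType R (reesAlgebra J))

variable [IsLocalRing R]

open IsLocalRing

/-- `M` strictly contains the prime `m_R R[t, t⁻¹] ∩ E`, since `t⁻¹` lies only in `M`; this supplies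
the extra `1` in the height. -/
theorem exists_isMaximal_extendedRees (F : IdealFiltration R) (h1 : F.I 1 ≠ ⊤) :
    ∃ M : Ideal F.extendedRees, M.IsMaximal ∧ F.tInv ∈ M ∧ M.LiesOver (maximalIdeal R) ∧
      (maximalIdeal R).height + 1 ≤ M.height := by
  have hne : Ideal.span {F.tInv} ⊔ F.extendedReesPrime (maximalIdeal R) ≠ ⊤ := by
    rw [Ideal.ne_top_iff_one]
    intro h
    obtain ⟨x, hx, y, hy, hxy⟩ := Submodule.mem_sup.mp h
    obtain ⟨g, rfl⟩ := Ideal.mem_span_singleton.mp hx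
    -- In degree `0`, a multiple of `t⁻¹` has its coefficient in `I 1`, which lies in the maximal
    -- ideal.
    have h0 := congr_arg (fun f : F.extendedRees ↦ (f : R[T;T⁻¹]).coeff 0) hxy
    rw [AddMemClass.coe_add, AddMonoidAlgebra.coeff_add, Finsupp.add_apply, MulMemClass.coe_mul,
      F.coeff_tInv_mul, OneMemClass.coe_one, ← T_zero, T_apply, if_pos rfl] at h0
    have hg : (g : R[T;T⁻¹]).coeff (0 + 1) ∈ F.I ((0 + 1 : ℤ).toNat) := g.2 (0 + 1)
    have : (1 : R) ∈ maximalIdeal R := by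
      rw [← h0]
      exact add_mem (le_maximalIdeal h1 hg) ((F.mem_extendedReesPrime _).mp hy 0)
    exact (Ideal.ne_top_iff_one _).mp (maximalIdeal.isMaximal R).ne_top this
  obtain ⟨M, hM, hle⟩ := Ideal.exists_le_maximal _ hne
  have hu : F.tInv ∈ M := hle (Ideal.mem_sup_left (Ideal.mem_span_singleton_self _))
  have hP : F.extendedReesPrime (maximalIdeal R) ≤ M := le_sup_right.trans hle
  refine ⟨M, hM, hu, ⟨?_⟩, ?_⟩
  · refine (maximalIdeal.isMaximal R).eq_of_le (Ideal.IsPrime.under R M).ne_top ?_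
    rw [← F.under_extendedReesPrime (maximalIdeal R)]
    exact Ideal.comap_mono hP
  · refine le_trans ?_ (Ideal.height_add_one_le_of_lt_of_isPrime
      (I := F.extendedReesPrime (maximalIdeal R)) (lt_of_le_of_ne hP ?_))
    · gcongr
      exact F.height_le_height_extendedReesPrime _
    · intro h
      rw [← h, mem_extendedReesPrime] at hu
      have := hu (-1)
      rw [tInv] at this
      simp only [T_apply, if_true] at this
      exact (Ideal.ne_top_iff_one _).mp (maximalIdeal.isMaximal R).ne_top this

variable [IsNoetherianRing R]

theorem IsNoetherianFiltration.height_le_analyticSpread {F : IdealFiltration R}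
    (hF : F.IsNoetherianFiltration) (h1 : F.I 1 ≠ ⊤) :
    (F.height : WithBot ℕ∞) ≤ F.analyticSpread := by
  obtain ⟨M, hM, hu, hMm, hMh⟩ := F.exists_isMaximal_extendedRees h1
  have := hF.finiteType_extendedRees
  have : IsNoetherianRing F.extendedRees := Algebra.FiniteType.isNoetherianRing R _
  let J := F.I 1
  let m := maximalIdeal R
  have hJm : J ≤ m := le_maximalIdeal h1
  let U : Ideal F.extendedRees := Ideal.span {F.tInv}
  have hUM : U ≤ M := (Ideal.span_singleton_le_iff_mem M).mpr hu
  have hJU : J ≤ U.comap (algebraMap R F.extendedRees) := by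
    intro a ha
    have ha' : a ∈ F.I (1 : ℤ).toNat := ha
    refine Ideal.mem_span_singleton.mpr ⟨⟨_, F.single_mem_extendedRees ha'⟩, Subtype.ext ?_⟩
    rw [MulMemClass.coe_mul, tInv]
    dsimp only
    rw [T, AddMonoidAlgebra.single_mul_single, one_mul]
    rfl
  -- Killing the single element `t⁻¹` lowers the height by at most one.
  have hM' : m.height ≤ (M.map (Ideal.Quotient.mk U)).height :=
    (ENat.add_le_add_iff_right ENat.one_ne_top).mp (hMh.trans (Ideal.height_le_height_add_one_of_mem hu))
  have hfib : ringKrullDim (F.extendedRees ⧸ U ⊔ m.map (algebraMap R F.extendedRees)) ≤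
      F.analyticSpread :=
    ringKrullDim_quotient_le_of_forall_exists_sub_mem F.toExtendedRees.toRingHom
      (F.exists_toExtendedRees_sub_mem m) (F.map_le_comap_toExtendedRees m)
  have hquot := J.height_add_ringKrullDim_quotient_le h1
  rw [← maximalIdeal_height_eq_ringKrullDim (R := R)] at hquot
  have : Nontrivial (R ⧸ J) := Ideal.Quotient.nontrivial_iff.mpr h1
  have : IsLocalRing (R ⧸ J) := .of_surjective' _ Ideal.Quotient.mk_surjective
  -- Finiteness of `dim R/J` allows it to be cancelled at the end.
  obtain ⟨n, hn⟩ : ∃ n : ℕ, ringKrullDim (R ⧸ J) = n := by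
    obtain ⟨n, hn⟩ := ENat.ne_top_iff_exists.mp
      (Ideal.height_ne_top_of_isPrime (I := maximalIdeal (R ⧸ J)))
    exact ⟨n, by rw [← maximalIdeal_height_eq_ringKrullDim, ← hn]; rfl⟩
  rw [hn] at hquot
  apply ENat.WithBot.add_le_add_natCast_right_iff (c := n).mp
  refine hquot.trans ((WithBot.coe_le_coe.mpr hM').trans ?_)
  refine (Ideal.height_map_quotientMk_le (m := m) hJU hUM).trans ?_
  rw [hn, add_comm]
  gcongr

theorem IsNoetherianFiltration.analyticSpread_le_of_le_mul {F : IdealFiltration R}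
    (hF : F.IsNoetherianFiltration) (h : ∀ n, F.I (n + 1) ≤ maximalIdeal R * F.I n) :
    F.analyticSpread ≤ ringKrullDim R := by
  have hE := ringKrullDim_quotient_succ_le_of_nonZeroDivisor F.tInv_mem_nonZeroDivisors
  have hC : F.analyticSpread ≤ ringKrullDim (F.extendedRees ⧸ Ideal.span {F.tInv}) := by
    refine (ringKrullDim_quotient_eq_of_forall_exists_sub_mem F.toExtendedRees.toRingHom
      (F.exists_toExtendedRees_sub_mem _) (F.map_eq_comap_toExtendedRees _ h)).trans_le ?_
    exact ringKrullDim_le_of_surjective (Ideal.Quotient.factor le_sup_left)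
      (Ideal.Quotient.factor_surjective _)
  exact hC.trans (ENat.WithBot.add_le_add_one_right_iff.mp
    (hE.trans hF.ringKrullDim_extendedRees_le))

end IdealFiltration

/-! ### Spreads of ideals and the conclusion -/

open IsLocalRing

theorem Ideal.analyticSpread_le_ringKrullDim {R : Type*} [CommRing R] [IsLocalRing R]
    [IsNoetherianRing R] {J : Ideal R} (hJ : J ≠ ⊤) : J.analyticSpread ≤ ringKrullDim R :=
  (IdealFiltration.isNoetherianFiltration_adic J).analyticSpread_le_of_le_mul fun n ↦ by
    change J ^ (n + 1) ≤ _ * J ^ n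
    rw [pow_succ']
    exact Ideal.mul_mono_left (le_maximalIdeal hJ)

/-- For the unit ideal the fibre ring is `k[t]`, with `k` the residue field. -/
theorem Ideal.analyticSpread_top_le_one {R : Type*} [CommRing R] [IsLocalRing R] :
    (⊤ : Ideal R).analyticSpread ≤ 1 := by
  let φ : reesAlgebra (⊤ : Ideal R) →+* (R ⧸ maximalIdeal R)[X] :=
    (Polynomial.mapRingHom (Ideal.Quotient.mk (maximalIdeal R))).comp
      ((reesAlgebra (⊤ : Ideal R)).val : _ →+* R[X])
  have hφ : Function.Surjective φ := by
    intro g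
    obtain ⟨f, rfl⟩ := Polynomial.map_surjective _ Ideal.Quotient.mk_surjective g
    exact ⟨⟨f, fun n ↦ by rw [Ideal.top_pow]; trivial⟩, rfl⟩
  have hker : RingHom.ker φ = (maximalIdeal R).map (algebraMap R (reesAlgebra (⊤ : Ideal R))) := by
    ext f
    refine Iff.trans ?_ ((IdealFiltration.adic ⊤).mem_map_algebraMap_rees_iff (maximalIdeal R)).symm
    rw [RingHom.mem_ker, Polynomial.ext_iff]
    refine forall_congr' fun n ↦ ?_
    change (Polynomial.map _ (f : R[X])).coeff n = 0 ↔ _ ∈ _ * ⊤ ^ n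
    rw [Polynomial.coeff_map, Ideal.Quotient.eq_zero_iff_mem, Ideal.top_pow, Ideal.mul_top]
  let _ : Field (R ⧸ maximalIdeal R) := Ideal.Quotient.field _
  rw [Ideal.analyticSpread, ringKrullDim_quotient_eq_of_ker_eq φ hφ hker, Polynomial.ringKrullDim_of_isNoetherianRing,
    ringKrullDim_eq_zero_of_field, zero_add]

theorem mainTheorem10 {R : Type*} [CommRing R] [IsLocalRing R] [IsNoetherianRing R]
    (F : IdealFiltration R) (hF : F.IsNoetherianFiltration) :
    (∃ e : ℕ, 0 < e ∧ ∀ m : ℕ, 0 < m → (F.I (e * m)).analyticSpread = F.analyticSpread) ∧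
    (F.I 1 ≠ ⊤ → (F.height : WithBot ℕ∞) ≤ F.analyticSpread) ∧
    (F.I 1 ≠ ⊤ ∨ 1 ≤ ringKrullDim R → F.analyticSpread ≤ ringKrullDim R) := by
  refine ⟨hF.exists_analyticSpread_eq, hF.height_le_analyticSpread, fun h ↦ ?_⟩
  obtain ⟨e, he, hspread⟩ := hF.exists_analyticSpread_eq
  -- Passing to the ideal `I_e` matters: `I_{n+1} ≤ m_R I_n` can fail for `F` but holds for powers
  -- of a proper ideal.
  rw [← hspread 1 one_pos, mul_one]
  by_cases hJ : F.I e = ⊤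
  · rw [hJ]
    -- `I_e = R` forces `I₁ = R`, leaving only the alternative `1 ≤ dim R`.
    refine Ideal.analyticSpread_top_le_one.trans (h.resolve_left fun h1 ↦ h1 ?_)
    exact top_le_iff.mp (hJ ▸ F.antitone he)
  · exact Ideal.analyticSpread_le_ringKrullDim hJ
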